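/- Let $k,n\ge 0$ be integers and let $FA=\mathbb F_2\langle a_1,\dots,a_k\rangle$ be the free associative algebra over the field with two elements, graded by the length of monomials. A *homogeneous monomial system* over $FA$ in the unknowns $x_1,\dots,x_n$ is a finite system of equations $u_i=v_i$, $1\le i\le s$, where each $u_i$ and $v_i$ is a word in the free semigroup generated by the unknowns $x_1,\dots,x_n$ and finitely many coefficients $c_1,\dots,c_\ell\in FA$, and where all the coefficients are homogeneous elements of $FA$ (not necessarily monomials). A *homogeneous solution* of such a system is a solution $(x_1^0,\dots,x_n^0)\in FA^n$ all of whose entries are homogeneous elements of $FA$, possibly of different degrees; here $0$ counts as homogeneous. Then the collection of the sets of homogeneous solutions of homogeneous monomial systems over $FA$ in $n$ unknowns is Noetherian: if $S_0\supseteq S_1\supseteq S_2\supseteq\cdots$ is a descending sequence of subsets of $FA^n$, each of which is the set of homogeneous solutions of some homogeneous monomial system over $FA$ in $x_1,\dots,x_n$, then there is an $N$ with $S_m=S_N$ for all $m\ge N$. -/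

import Mathlib

namespace MonomialEquations

/-- The free associative (unital) algebra `FA = GF₂⟨a₁, …, a_k⟩` over the field with two elements. -/
abbrev FA (k : ℕ) : Type := FreeAlgebra (ZMod 2) (Fin k)

/-- The monomial `a_{i₁} ⋯ a_{i_d}` of `FA` given by the word `w = i₁ ⋯ i_d`. -/
noncomputable def monomial {k : ℕ} (w : FreeMonoid (Fin k)) : FA k :=
  FreeMonoid.lift (FreeAlgebra.ι (ZMod 2)) w

/-- The homogeneous component of degree `d` of `FA`: the linear span of the monomials of
length `d`. -/
noncomputable def homogeneousPart (k d : ℕ) : Submodule (ZMod 2) (FA k) :=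
  Submodule.span (ZMod 2) {m | ∃ w : FreeMonoid (Fin k), w.length = d ∧ monomial w = m}

/-- An element of `FA` is homogeneous if it lies in `homogeneousPart k d` for some `d`
(in particular, `0` is homogeneous). -/
def IsHomogeneous {k : ℕ} (a : FA k) : Prop :=
  SetLike.IsHomogeneousElem (homogeneousPart k) a

/-- A monomial system of equations `u_i = v_i` (`i < numEqs`) over `FA` in `n` unknowns: each side
is a word in the free semigroup on (symbols for) the finitely many coefficients and the unknowns.
The coefficients are arbitrary elements of `FA`. -/
structure MonomialSystem (k n : ℕ) where
  /-- the number of coefficients -/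
  numCoeffs : ℕ
  /-- the coefficients -/
  coeff : Fin numCoeffs → FA k
  /-- the number of equations -/
  numEqs : ℕ
  /-- the left-hand sides -/
  lhs : Fin numEqs → FreeSemigroup (Fin numCoeffs ⊕ Fin n)
  /-- the right-hand sides -/
  rhs : Fin numEqs → FreeSemigroup (Fin numCoeffs ⊕ Fin n)

namespace MonomialSystem

variable {k n : ℕ}

/-- A monomial system is homogeneous if all its coefficients are homogeneous elements of `FA`. -/
def Homogeneous (Φ : MonomialSystem k n) : Prop :=
  ∀ j, IsHomogeneous (Φ.coeff j)

/-- The value in `FA` of a word in the coefficients and the unknowns, under the assignment `x`. -/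
noncomputable def evalWord (Φ : MonomialSystem k n) (x : Fin n → FA k) :
    FreeSemigroup (Fin Φ.numCoeffs ⊕ Fin n) →ₙ* FA k :=
  FreeSemigroup.lift (Sum.elim Φ.coeff x)

/-- The assignment `x` satisfies all equations of the system. -/
def IsSolution (Φ : MonomialSystem k n) (x : Fin n → FA k) : Prop :=
  ∀ i, Φ.evalWord x (Φ.lhs i) = Φ.evalWord x (Φ.rhs i)

/-- The set of homogeneous solutions: the solutions all of whose entries are homogeneous
(possibly of different degrees). -/
def homogeneousSolutions (Φ : MonomialSystem k n) : Set (Fin n → FA k) :=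
  {x | (∀ j, IsHomogeneous (x j)) ∧ Φ.IsSolution x}

end MonomialSystem

/-- The collection of the sets of homogeneous solutions of homogeneous monomial systems over `FA`
in `n` unknowns. -/
def homogeneousSolutionSets (k n : ℕ) : Set (Set (Fin n → FA k)) :=
  {S | ∃ Φ : MonomialSystem k n, Φ.Homogeneous ∧ Φ.homogeneousSolutions = S}

end MonomialEquations

open FreeAlgebra

/-! ### Unique factorization in graded monoids. -/

section FreeFactorization

variable {M : Type*} [LeftCancelMonoid M] {deg : M → ℕ}

/-! The nonzero homogeneous elements of `FA` form a free monoid on their irreducibles: if `a * b = c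
* d` with `deg a ≤ deg c`, then `a` divides `c` on the left (`exists_eq_mul_of_mul_eq_mul`), and
over the two-element field the only unit is `1`. The monoid is countable, so it embeds in 2×2
integer matrices; sending `0` to the zero matrix covers all homogeneous elements
(`exists_matrix_embedding`). Monomial equations thus become polynomial equations over ℤ in `4 * n`
variables. Each solution set is recovered from its vanishing ideal
(`mem_iff_of_mem_homogeneousSolutionSets`), and Hilbert's basis theorem stabilizes the ascending
ideals. -/

theorem eq_one_of_isUnit_of_deg (hmul : ∀ a b, deg (a * b) = deg a + deg b)
    (hone : ∀ a, deg a = 0 → a = 1) {a : M} (ha : IsUnit a) : a = 1 := by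
  obtain ⟨b, hb⟩ := ha.exists_right_inv
  have h1 : deg (1 : M) = 0 := by simpa using hmul 1 1
  have h2 := hmul a b
  rw [hb, h1] at h2
  exact hone a (by omega)

theorem lift_irreducible_surjective (hmul : ∀ a b, deg (a * b) = deg a + deg b)
    (hone : ∀ a, deg a = 0 → a = 1) :
    Function.Surjective (FreeMonoid.lift (fun p : {p : M // Irreducible p} => (p : M))) := by
  suffices h : ∀ d a, deg a = d →
      ∃ w, FreeMonoid.lift (fun p : {p : M // Irreducible p} => (p : M)) w = a from
    fun a => h _ a rfl
  intro d
  induction d using Nat.strong_induction_on with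
  | _ d ih =>
    intro a ha
    by_cases h1 : IsUnit a
    · exact ⟨1, by rw [map_one, eq_one_of_isUnit_of_deg hmul hone h1]⟩
    by_cases h2 : Irreducible a
    · exact ⟨FreeMonoid.of ⟨a, h2⟩, by simp⟩
    rw [irreducible_iff] at h2
    push Not at h2
    obtain ⟨b, c, rfl, hb, hc⟩ := h2 h1
    have hb' : deg b ≠ 0 := fun h => hb (hone b h ▸ isUnit_one)
    have hc' : deg c ≠ 0 := fun h => hc (hone c h ▸ isUnit_one)
    rw [hmul] at ha
    obtain ⟨u, hu⟩ := ih (deg b) (by omega) b rfl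
    obtain ⟨v, hv⟩ := ih (deg c) (by omega) c rfl
    exact ⟨u * v, by rw [map_mul, hu, hv]⟩

/-- The factor of smaller degree divides the other on the left; by irreducibility the quotient is a
unit, hence `1`. -/
theorem irreducible_eq_of_mul_eq_mul (hmul : ∀ a b, deg (a * b) = deg a + deg b)
    (hone : ∀ a, deg a = 0 → a = 1)
    (hdiv : ∀ a b c d : M, a * b = c * d → deg a ≤ deg c → ∃ e, c = a * e)
    {p q x y : M} (hp : Irreducible p) (hq : Irreducible q) (h : p * x = q * y) : p = q := by
  have key : ∀ {p q x y : M}, Irreducible p → Irreducible q → p * x = q * y → deg p ≤ deg q →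
      p = q := by
    intro p q x y hp hq h hle
    obtain ⟨e, he⟩ := hdiv p x q y h hle
    rcases hq.isUnit_or_isUnit he with hu | hu
    · exact absurd hu hp.not_isUnit
    · rw [he, eq_one_of_isUnit_of_deg hmul hone hu, mul_one]
  rcases le_total (deg p) (deg q) with hle | hle
  · exact key hp hq h hle
  · exact (key hq hp h.symm hle).symm

theorem lift_irreducible_injective (hmul : ∀ a b, deg (a * b) = deg a + deg b)
    (hone : ∀ a, deg a = 0 → a = 1)
    (hdiv : ∀ a b c d : M, a * b = c * d → deg a ≤ deg c → ∃ e, c = a * e) :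
    Function.Injective (FreeMonoid.lift (fun p : {p : M // Irreducible p} => (p : M))) := by
  have hne : ∀ (p : {p : M // Irreducible p}) (x : M), (p : M) * x ≠ 1 := by
    intro p x h
    have h1 : deg (1 : M) = 0 := by simpa using hmul 1 1
    have h2 := hmul p x
    rw [h, h1] at h2
    exact p.2.not_isUnit (hone p (by omega) ▸ isUnit_one)
  intro u
  induction u using FreeMonoid.recOn with
  | one =>
    intro v h
    cases v using FreeMonoid.casesOn with
    | one => rfl
    | of_mul q v =>
      rw [map_one, map_mul, FreeMonoid.lift_eval_of] at h
      exact absurd h.symm (hne _ _)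
  | of_mul p u ih =>
    intro v h
    cases v using FreeMonoid.casesOn with
    | one =>
      rw [map_one, map_mul, FreeMonoid.lift_eval_of] at h
      exact absurd h (hne _ _)
    | of_mul q v =>
      simp only [map_mul, FreeMonoid.lift_eval_of] at h
      obtain rfl : p = q :=
        Subtype.ext (irreducible_eq_of_mul_eq_mul hmul hone hdiv p.2 q.2 h)
      rw [ih (mul_left_cancel h)]

end FreeFactorization

/-! ### Free monoids inside 2×2 integer matrices. -/

section MatrixEmbedding

/-- The matrix of the affine map `t ↦ 2 ^ i * (2 * t + 1)`. -/
def affineMatrix (i : ℕ) : Matrix (Fin 2) (Fin 2) ℤ :=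
  !![2 ^ (i + 1), 2 ^ i; 0, 1]

theorem two_pow_mul_odd_inj {i j a b : ℕ} (h : 2 ^ i * (2 * a + 1) = 2 ^ j * (2 * b + 1)) :
    i = j ∧ a = b := by
  have key : ∀ {i j a b : ℕ}, 2 ^ i * (2 * a + 1) = 2 ^ j * (2 * b + 1) → i ≤ j →
      i = j ∧ a = b := by
    intro i j a b h hle
    obtain ⟨c, rfl⟩ := Nat.exists_eq_add_of_le hle
    rw [pow_add, mul_assoc] at h
    have h' := Nat.eq_of_mul_eq_mul_left (by positivity) h
    cases c with
    | zero => simp at h'; exact ⟨rfl, h'⟩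
    | succ c => rw [pow_succ, mul_assoc, mul_left_comm] at h'; omega
  rcases le_total i j with hle | hle
  · exact key h hle
  · obtain ⟨h1, h2⟩ := key h.symm hle
    exact ⟨h1.symm, h2.symm⟩

/-- The image of `0` under the composite of the affine maps attached to a word. -/
def affineOrbit : List ℕ → ℕ
  | [] => 0
  | i :: w => 2 ^ i * (2 * affineOrbit w + 1)

/-- A positive integer is `2 ^ i * (2 * t + 1)` for exactly one pair `(i, t)`, so the first letter
can be read off and removed; `0` is reached only by the empty word. -/
theorem affineOrbit_injective : Function.Injective affineOrbit := by
  intro u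
  induction u with
  | nil =>
    intro v h
    cases v with
    | nil => rfl
    | cons j v => simp [affineOrbit] at h
  | cons i u ih =>
    intro v h
    cases v with
    | nil => simp [affineOrbit] at h
    | cons j v =>
      obtain ⟨rfl, h2⟩ := two_pow_mul_odd_inj h
      rw [ih h2]

theorem lift_affineMatrix_apply (w : FreeMonoid ℕ) :
    FreeMonoid.lift affineMatrix w 0 1 = affineOrbit w.toList ∧
      FreeMonoid.lift affineMatrix w 1 1 = 1 := by
  induction w using FreeMonoid.recOn with
  | one => simp [affineOrbit]
  | of_mul i w ih =>
    rw [map_mul, FreeMonoid.lift_eval_of, FreeMonoid.toList_of_mul]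
    simp only [Matrix.mul_apply, Fin.sum_univ_two, ih.1, ih.2]
    simp [affineMatrix, affineOrbit]
    ring

theorem exists_injective_monoidHom_matrix {M : Type*} [LeftCancelMonoid M] [Countable M]
    (deg : M → ℕ) (hmul : ∀ a b, deg (a * b) = deg a + deg b) (hone : ∀ a, deg a = 0 → a = 1)
    (hdiv : ∀ a b c d : M, a * b = c * d → deg a ≤ deg c → ∃ e, c = a * e) :
    ∃ f : M →* Matrix (Fin 2) (Fin 2) ℤ, Function.Injective f ∧ ∀ a, f a ≠ 0 := by
  let e := MulEquiv.ofBijective _ ⟨lift_irreducible_injective hmul hone hdiv,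
    lift_irreducible_surjective hmul hone⟩
  obtain ⟨g, hg⟩ := Countable.exists_injective_nat {p : M // Irreducible p}
  refine ⟨((FreeMonoid.lift affineMatrix).comp (FreeMonoid.map g)).comp e.symm.toMonoidHom,
    ?_, ?_⟩
  · intro a b h
    apply e.symm.injective
    have h' := congrFun (congrFun h 0) 1
    simp only [MonoidHom.comp_apply, (lift_affineMatrix_apply _).1, Nat.cast_inj] at h'
    have h'' := affineOrbit_injective h'
    exact List.map_injective_iff.2 hg h''
  · intro a h
    -- The lower right entry of a product of affine matrices is always `1`.
    have h' := congrFun (congrFun h 1) 1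
    simp [(lift_affineMatrix_apply _).2] at h'

end MatrixEmbedding

/-! ### Coefficients and left division in the free algebra. -/

namespace MonomialEquations

variable {k n : ℕ}

/-- The coefficient of the monomial `w` in an element of the free algebra. -/
noncomputable def wordCoeff (w : FreeMonoid (Fin k)) : FA k →ₗ[ZMod 2] ZMod 2 :=
  Finsupp.lapply w ∘ₗ (MonoidAlgebra.coeffLinearEquiv (ZMod 2)).toLinearMap ∘ₗ
    (equivMonoidAlgebraFreeMonoid (R := ZMod 2) (X := Fin k)).toLinearMap

theorem wordCoeff_apply (w : FreeMonoid (Fin k)) (a : FA k) :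
    wordCoeff w a = (equivMonoidAlgebraFreeMonoid a).coeff w := rfl

theorem equivMonoidAlgebraFreeMonoid_monomial (w : FreeMonoid (Fin k)) :
    equivMonoidAlgebraFreeMonoid (monomial w) = MonoidAlgebra.single w (1 : ZMod 2) := by
  induction w using FreeMonoid.recOn with
  | one => simp [monomial, MonoidAlgebra.one_def]
  | of_mul i w ih =>
    rw [monomial] at ih
    rw [monomial, map_mul, map_mul, ih, FreeMonoid.lift_eval_of]
    simp [equivMonoidAlgebraFreeMonoid, MonoidAlgebra.single_mul_single]

theorem ext_wordCoeff {a b : FA k} (h : ∀ w, wordCoeff w a = wordCoeff w b) : a = b := by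
  apply (equivMonoidAlgebraFreeMonoid (R := ZMod 2) (X := Fin k)).injective
  apply MonoidAlgebra.coeff_injective
  ext w
  exact h w

theorem wordCoeff_monomial (u w : FreeMonoid (Fin k)) [Decidable (u = w)] :
    wordCoeff w (monomial u) = if u = w then 1 else 0 := by
  classical
  rw [wordCoeff_apply, equivMonoidAlgebraFreeMonoid_monomial, MonoidAlgebra.coeff_single,
    Finsupp.single_apply]

theorem mem_homogeneousPart_iff {d : ℕ} {a : FA k} :
    a ∈ homogeneousPart k d ↔ ∀ w, wordCoeff w a ≠ 0 → w.length = d := by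
  classical
  constructor
  · intro ha w hw
    induction ha using Submodule.span_induction with
    | mem x hx =>
      obtain ⟨u, hu, rfl⟩ := hx
      rw [wordCoeff_monomial] at hw
      by_cases h : u = w
      · rw [← h, hu]
      · simp [h] at hw
    | zero => simp at hw
    | add x y _ _ hx hy =>
      by_contra hne
      exact hw (by rw [map_add, not_not.1 (mt hx hne), not_not.1 (mt hy hne), add_zero])
    | smul r x _ hx =>
      exact hx (fun h => hw (by rw [map_smul, h, smul_zero]))
  · intro h
    have hsum : a = ∑ w ∈ (equivMonoidAlgebraFreeMonoid a).coeff.support,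
        wordCoeff w a • monomial w := by
      apply ext_wordCoeff
      intro w
      simp only [map_sum, map_smul, wordCoeff_monomial, smul_eq_mul, mul_ite, mul_one, mul_zero,
        Finset.sum_ite_eq', Finsupp.mem_support_iff]
      split_ifs with h0
      · rfl
      · exact not_not.1 h0
    rw [hsum]
    refine Submodule.sum_mem _ fun w hw => Submodule.smul_mem _ _ (Submodule.subset_span ?_)
    exact ⟨w, h w (Finsupp.mem_support_iff.1 hw), rfl⟩

/-- A word has only one prefix of length `p`, so a single term of the product contributes. -/
theorem wordCoeff_mul {p : ℕ} {a : FA k} (ha : a ∈ homogeneousPart k p) (b : FA k)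
    {u : FreeMonoid (Fin k)} (hu : u.length = p) (v : FreeMonoid (Fin k)) :
    wordCoeff (u * v) (a * b) = wordCoeff u a * wordCoeff v b := by
  classical
  induction ha using Submodule.span_induction with
  | mem x hx =>
    obtain ⟨u', hu', rfl⟩ := hx
    rw [wordCoeff_monomial, wordCoeff_apply,
      map_mul equivMonoidAlgebraFreeMonoid, equivMonoidAlgebraFreeMonoid_monomial]
    by_cases h : u' = u
    · subst h
      rw [MonoidAlgebra.coeff_single_mul_eq_mul_coeff (m₂ := v) (by simp), if_pos rfl,
        wordCoeff_apply]
    · rw [if_neg h, zero_mul]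
      refine MonoidAlgebra.coeff_single_mul_of_forall_mul_ne _ _ fun d hd => h ?_
      exact (List.append_inj hd (hu'.trans hu.symm)).1
  | zero => simp
  | add x y _ _ hx hy => rw [add_mul, map_add, hx, hy, map_add, add_mul]
  | smul r x _ hx => rw [smul_mul_assoc, map_smul, hx, map_smul, smul_mul_assoc]

instance homogeneousPart.gradedMonoid : SetLike.GradedMonoid (homogeneousPart k) where
  one_mem := Submodule.subset_span ⟨1, rfl, map_one _⟩
  mul_mem := by
    intro i j a b ha hb
    have h := Submodule.mul_mem_mul ha hb
    rw [homogeneousPart, homogeneousPart, Submodule.span_mul_span] at h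
    refine Submodule.span_mono ?_ h
    rintro _ ⟨_, ⟨u, hu, rfl⟩, _, ⟨v, hv, rfl⟩, rfl⟩
    exact ⟨u * v, by rw [FreeMonoid.length_mul, hu, hv], map_mul _ _ _⟩

theorem exists_wordCoeff_ne_zero {a : FA k} (ha : a ≠ 0) : ∃ w, wordCoeff w a ≠ 0 := by
  by_contra! h
  exact ha (ext_wordCoeff fun w => by rw [h w, map_zero])

theorem degree_unique {a : FA k} (ha : a ≠ 0) {p q : ℕ} (hp : a ∈ homogeneousPart k p)
    (hq : a ∈ homogeneousPart k q) : p = q := by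
  obtain ⟨w, hw⟩ := exists_wordCoeff_ne_zero ha
  rw [← mem_homogeneousPart_iff.1 hp w hw, ← mem_homogeneousPart_iff.1 hq w hw]

theorem eq_one_of_ne_zero_of_zmod_two {x : ZMod 2} (hx : x ≠ 0) : x = 1 := by
  revert x
  decide

theorem eq_one_of_mem_homogeneousPart_zero {a : FA k} (ha : a ∈ homogeneousPart k 0)
    (h0 : a ≠ 0) : a = 1 := by
  classical
  rw [mem_homogeneousPart_iff] at ha
  obtain ⟨w, hw⟩ := exists_wordCoeff_ne_zero h0
  have h1 : (1 : FA k) = monomial 1 := (map_one _).symm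
  apply ext_wordCoeff
  intro v
  rw [h1, wordCoeff_monomial]
  have hw1 := FreeMonoid.length_eq_zero.1 (ha w hw)
  split_ifs with h
  · rw [← h, ← hw1]
    exact eq_one_of_ne_zero_of_zmod_two hw
  · by_contra hv
    exact h (FreeMonoid.length_eq_zero.1 (ha v hv)).symm

/-- The element obtained from `b` by keeping only the monomials ending in `w`, and deleting this
suffix from them. -/
noncomputable def removeSuffix (w : FreeMonoid (Fin k)) (b : FA k) : FA k :=
  equivMonoidAlgebraFreeMonoid.symm (MonoidAlgebra.ofCoeff
    ((equivMonoidAlgebraFreeMonoid b).coeff.comapDomain (· * w)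
      (mul_left_injective w).injOn))

theorem wordCoeff_removeSuffix (w : FreeMonoid (Fin k)) (b : FA k) (v : FreeMonoid (Fin k)) :
    wordCoeff v (removeSuffix w b) = wordCoeff (v * w) b := by
  rw [wordCoeff_apply, removeSuffix, AlgEquiv.apply_symm_apply, MonoidAlgebra.coeff_ofCoeff,
    Finsupp.comapDomain_apply, wordCoeff_apply]

/-- Fix a word `w` occurring in `d`, necessarily with coefficient `1`. Comparing coefficients at
words ending in `w` on both sides of `a * b = c * d` gives `c = a * removeSuffix w b`. -/
theorem exists_eq_mul_of_mul_eq_mul {p q r s : ℕ} {a b c d : FA k} (ha : a ∈ homogeneousPart k p)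
    (hb : b ∈ homogeneousPart k q) (hc : c ∈ homogeneousPart k r) (hd : d ∈ homogeneousPart k s)
    (hc0 : c ≠ 0) (hd0 : d ≠ 0) (h : a * b = c * d) (hpr : p ≤ r) :
    ∃ e ∈ homogeneousPart k (r - p), c = a * e := by
  obtain ⟨w, hw⟩ := exists_wordCoeff_ne_zero hd0
  have hws := mem_homogeneousPart_iff.1 hd w hw
  have hab : a * b ≠ 0 := h ▸ mul_ne_zero hc0 hd0
  have hdeg : p + q = r + s := degree_unique hab (SetLike.mul_mem_graded ha hb)
    (h ▸ SetLike.mul_mem_graded hc hd)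
  have he : removeSuffix w b ∈ homogeneousPart k (r - p) := by
    rw [mem_homogeneousPart_iff] at hb ⊢
    intro v hv
    rw [wordCoeff_removeSuffix] at hv
    have := hb _ hv
    rw [FreeMonoid.length_mul, hws] at this
    omega
  refine ⟨_, he, ext_wordCoeff fun x => ?_⟩
  by_cases hx : x.length = r
  · obtain ⟨u, v, rfl, hu⟩ : ∃ u v : FreeMonoid (Fin k), x = u * v ∧ u.length = p :=
      ⟨FreeMonoid.ofList (x.toList.take p), FreeMonoid.ofList (x.toList.drop p),
        (List.take_append_drop p x.toList).symm, by
          change (x.toList.take p).length = p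
          rw [List.length_take]
          exact min_eq_left (hpr.trans_eq hx.symm)⟩
    rw [wordCoeff_mul ha _ hu, wordCoeff_removeSuffix, ← wordCoeff_mul ha _ hu, h, ← mul_assoc,
      wordCoeff_mul hc _ hx, eq_one_of_ne_zero_of_zmod_two hw, mul_one]
  · have hae := SetLike.mul_mem_graded ha he
    rw [Nat.add_sub_cancel' hpr] at hae
    rw [not_not.1 (mt (mem_homogeneousPart_iff.1 hc x) hx),
      not_not.1 (mt (mem_homogeneousPart_iff.1 hae x) hx)]

/-! ### The monoid of nonzero homogeneous elements and its matrix embedding. -/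

/-- The monoid of nonzero homogeneous elements of `FA`. -/
noncomputable def nonzeroHomogeneous (k : ℕ) : Submonoid (FA k) :=
  SetLike.homogeneousSubmonoid (homogeneousPart k) ⊓ nonZeroDivisors (FA k)

theorem nonzeroHomogeneous.isHomogeneous (a : nonzeroHomogeneous k) :
    IsHomogeneous (a : FA k) := a.2.1

theorem nonzeroHomogeneous.ne_zero (a : nonzeroHomogeneous k) : (a : FA k) ≠ 0 :=
  nonZeroDivisors.ne_zero a.2.2

theorem mem_nonzeroHomogeneous {a : FA k} (ha : IsHomogeneous a) (h0 : a ≠ 0) :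
    a ∈ nonzeroHomogeneous k :=
  ⟨ha, mem_nonZeroDivisors_of_ne_zero h0⟩

noncomputable instance nonzeroHomogeneous.leftCancelMonoid :
    LeftCancelMonoid (nonzeroHomogeneous k) where
  mul_left_cancel a _ _ h :=
    Subtype.ext (mul_left_cancel₀ (nonzeroHomogeneous.ne_zero a) (congrArg Subtype.val h))

/-- The degree of a nonzero homogeneous element. -/
noncomputable def nonzeroHomogeneous.degree (a : nonzeroHomogeneous k) : ℕ :=
  (nonzeroHomogeneous.isHomogeneous a).choose

theorem nonzeroHomogeneous.mem_degree (a : nonzeroHomogeneous k) :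
    (a : FA k) ∈ homogeneousPart k (nonzeroHomogeneous.degree a) :=
  (nonzeroHomogeneous.isHomogeneous a).choose_spec

instance countable_FA : Countable (FA k) :=
  ((equivMonoidAlgebraFreeMonoid (R := ZMod 2) (X := Fin k)).toEquiv.trans
    MonoidAlgebra.coeffEquiv).injective.countable

open nonzeroHomogeneous in
theorem exists_matrix_embedding (k : ℕ) : ∃ f : FA k → Matrix (Fin 2) (Fin 2) ℤ,
    (∀ a b, IsHomogeneous a → IsHomogeneous b → f (a * b) = f a * f b) ∧
      Set.InjOn f {a | IsHomogeneous a} := by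
  classical
  obtain ⟨f, hf, hf0⟩ := exists_injective_monoidHom_matrix
    (nonzeroHomogeneous.degree (k := k))
    (fun a b => degree_unique (ne_zero (a * b)) (mem_degree (a * b))
      (SetLike.mul_mem_graded (mem_degree a) (mem_degree b)))
    (fun a ha => Subtype.ext
      (eq_one_of_mem_homogeneousPart_zero (ha ▸ mem_degree a) (ne_zero a)))
    (fun a b c d h hle => by
      obtain ⟨e, he, hce⟩ := exists_eq_mul_of_mul_eq_mul (mem_degree a) (mem_degree b)
        (mem_degree c) (mem_degree d) (ne_zero c) (ne_zero d) (congrArg Subtype.val h) hle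
      have he0 : e ≠ 0 := fun h0 => (ne_zero c) (by rw [hce, h0, mul_zero])
      exact ⟨⟨e, mem_nonzeroHomogeneous ⟨_, he⟩ he0⟩, Subtype.ext hce⟩)
  have hz : (0 : FA k) ∉ nonzeroHomogeneous k := fun h => ne_zero ⟨0, h⟩ rfl
  refine ⟨fun a => if h : a ∈ nonzeroHomogeneous k then f ⟨a, h⟩ else 0, ?_, ?_⟩
  · intro a b ha hb
    by_cases ha0 : a = 0
    · simp [ha0, hz]
    by_cases hb0 : b = 0
    · simp [hb0, hz]
    have ha' := mem_nonzeroHomogeneous ha ha0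
    have hb' := mem_nonzeroHomogeneous hb hb0
    simp only [ha', hb', mul_mem ha' hb', dite_true]
    rw [← map_mul]
    rfl
  · intro a ha b hb h
    by_cases ha0 : a = 0 <;> by_cases hb0 : b = 0
    · rw [ha0, hb0]
    · simp only [ha0, hz, mem_nonzeroHomogeneous hb hb0, dite_true, dite_false] at h
      exact absurd h.symm (hf0 _)
    · simp only [hb0, hz, mem_nonzeroHomogeneous ha ha0, dite_true, dite_false] at h
      exact absurd h (hf0 _)
    · simp only [mem_nonzeroHomogeneous ha ha0, mem_nonzeroHomogeneous hb hb0, dite_true] at h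
      exact congrArg Subtype.val (hf h)

/-! ### From monomial systems to polynomial ideals. -/

theorem MonomialSystem.isHomogeneous_evalWord {Φ : MonomialSystem k n} (hΦ : Φ.Homogeneous)
    {x : Fin n → FA k} (hx : ∀ j, IsHomogeneous (x j))
    (w : FreeSemigroup (Fin Φ.numCoeffs ⊕ Fin n)) : IsHomogeneous (Φ.evalWord x w) := by
  induction w using FreeSemigroup.recOnMul with
  | ih1 s => cases s with
    | inl i => exact hΦ i
    | inr j => exact hx j
  | ih2 s w hs hw =>
    rw [map_mul]
    exact SetLike.IsHomogeneousElem.mul hs hw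

/-- The generic matrix attached to a word in the coefficients and the unknowns: the coefficients
are replaced by their images under `f`, and the unknowns by matrices of indeterminates. -/
noncomputable def MonomialSystem.genericWord (Φ : MonomialSystem k n)
    (f : FA k → Matrix (Fin 2) (Fin 2) ℤ) :
    FreeSemigroup (Fin Φ.numCoeffs ⊕ Fin n) →ₙ*
      Matrix (Fin 2) (Fin 2) (MvPolynomial (Fin n × Fin 2 × Fin 2) ℤ) :=
  FreeSemigroup.lift (Sum.elim (fun i => (f (Φ.coeff i)).map MvPolynomial.C)
    (fun j => Matrix.of fun r s => MvPolynomial.X (j, r, s)))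

/-- Evaluation of polynomials at the entries of the matrices `f (x j)`. -/
noncomputable def matrixEval (f : FA k → Matrix (Fin 2) (Fin 2) ℤ) (x : Fin n → FA k) :
    MvPolynomial (Fin n × Fin 2 × Fin 2) ℤ →+* ℤ :=
  MvPolynomial.eval fun i => f (x i.1) i.2.1 i.2.2

theorem MonomialSystem.map_genericWord {Φ : MonomialSystem k n} (hΦ : Φ.Homogeneous)
    {f : FA k → Matrix (Fin 2) (Fin 2) ℤ}
    (hf : ∀ a b, IsHomogeneous a → IsHomogeneous b → f (a * b) = f a * f b)
    {x : Fin n → FA k} (hx : ∀ j, IsHomogeneous (x j))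
    (w : FreeSemigroup (Fin Φ.numCoeffs ⊕ Fin n)) :
    (Φ.genericWord f w).map (matrixEval f x) = f (Φ.evalWord x w) := by
  induction w using FreeSemigroup.recOnMul with
  | ih1 s => cases s with
    | inl i => ext r s; simp [genericWord, evalWord, matrixEval]
    | inr j => ext r s; simp [genericWord, evalWord, matrixEval]
  | ih2 s w hs hw =>
    rw [map_mul, map_mul, hf _ _ (isHomogeneous_evalWord hΦ hx _) (isHomogeneous_evalWord hΦ hx _),
      ← hs, ← hw, Matrix.map_mul]

theorem MonomialSystem.isSolution_iff {Φ : MonomialSystem k n} (hΦ : Φ.Homogeneous)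
    {f : FA k → Matrix (Fin 2) (Fin 2) ℤ}
    (hf : ∀ a b, IsHomogeneous a → IsHomogeneous b → f (a * b) = f a * f b)
    (hinj : Set.InjOn f {a | IsHomogeneous a})
    {x : Fin n → FA k} (hx : ∀ j, IsHomogeneous (x j)) :
    Φ.IsSolution x ↔ ∀ i r s, matrixEval f x
      (Φ.genericWord f (Φ.lhs i) r s - Φ.genericWord f (Φ.rhs i) r s) = 0 := by
  refine forall_congr' fun i => ?_
  rw [← hinj.eq_iff (isHomogeneous_evalWord hΦ hx _) (isHomogeneous_evalWord hΦ hx _),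
    ← map_genericWord hΦ hf hx, ← map_genericWord hΦ hf hx, ← Matrix.ext_iff]
  simp only [Matrix.map_apply, map_sub, sub_eq_zero]

/-- The ideal of polynomials vanishing at the matrices attached to the points of `S`. -/
noncomputable def vanishingIdeal (f : FA k → Matrix (Fin 2) (Fin 2) ℤ)
    (S : Set (Fin n → FA k)) : Ideal (MvPolynomial (Fin n × Fin 2 × Fin 2) ℤ) :=
  ⨅ x ∈ S, RingHom.ker (matrixEval f x)

theorem mem_vanishingIdeal {f : FA k → Matrix (Fin 2) (Fin 2) ℤ} {S : Set (Fin n → FA k)}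
    {p : MvPolynomial (Fin n × Fin 2 × Fin 2) ℤ} :
    p ∈ vanishingIdeal f S ↔ ∀ x ∈ S, matrixEval f x p = 0 := by
  simp [vanishingIdeal, Submodule.mem_iInf, RingHom.mem_ker]

/-- The entrywise polynomials of any system defining `S` already lie in the vanishing ideal of `S`,
so no point outside `S` with homogeneous entries kills that ideal. -/
theorem mem_iff_of_mem_homogeneousSolutionSets {f : FA k → Matrix (Fin 2) (Fin 2) ℤ}
    (hf : ∀ a b, IsHomogeneous a → IsHomogeneous b → f (a * b) = f a * f b)
    (hinj : Set.InjOn f {a | IsHomogeneous a}) {S : Set (Fin n → FA k)}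
    (hS : S ∈ homogeneousSolutionSets k n) (x : Fin n → FA k) :
    x ∈ S ↔ (∀ j, IsHomogeneous (x j)) ∧ ∀ p ∈ vanishingIdeal f S, matrixEval f x p = 0 := by
  obtain ⟨Φ, hΦ, rfl⟩ := hS
  constructor
  · exact fun hx => ⟨hx.1, fun p hp => mem_vanishingIdeal.1 hp x hx⟩
  · rintro ⟨hx, h⟩
    refine ⟨hx, (Φ.isSolution_iff hΦ hf hinj hx).2 fun i r s => h _ ?_⟩
    exact mem_vanishingIdeal.2 fun y hy => (Φ.isSolution_iff hΦ hf hinj hy.1).1 hy.2 i r s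

end MonomialEquations

theorem corollary1p2 (k n : ℕ) (S : ℕ → Set (Fin n → MonomialEquations.FA k))
    (hS : ∀ i, S i ∈ MonomialEquations.homogeneousSolutionSets k n)
    (hdesc : ∀ i, S (i + 1) ⊆ S i) :
    ∃ N, ∀ m, N ≤ m → S m = S N := by
  obtain ⟨f, hf, hinj⟩ := MonomialEquations.exists_matrix_embedding k
  have hmono : Monotone fun i => MonomialEquations.vanishingIdeal f (S i) :=
    monotone_nat_of_le_succ fun i _ hp => MonomialEquations.mem_vanishingIdeal.2 fun x hx =>
      MonomialEquations.mem_vanishingIdeal.1 hp x (hdesc i hx)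
  obtain ⟨N, hN⟩ := monotone_stabilizes_iff_noetherian.2
    (inferInstance : IsNoetherianRing (MvPolynomial (Fin n × Fin 2 × Fin 2) ℤ)) ⟨_, hmono⟩
  refine ⟨N, fun m hm => Set.ext fun x => ?_⟩
  have hNm : MonomialEquations.vanishingIdeal f (S N) =
      MonomialEquations.vanishingIdeal f (S m) := hN m hm
  rw [MonomialEquations.mem_iff_of_mem_homogeneousSolutionSets hf hinj (hS m),
    MonomialEquations.mem_iff_of_mem_homogeneousSolutionSets hf hinj (hS N), hNm]
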